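/- Let $I$ be a finite set and let $A=(a_{ij})_{i,j\in I}$ be an E-generalized Cartan matrix: a real matrix with $a_{ii}=2$, with $a_{ij}\le 0$ for $i\ne j$, with $a_{ji}\ne 0$ whenever $a_{ij}\neq 0$, and such that for $i\ne j$ either $a_{ij}a_{ji}\ge 4$ or $a_{ij}a_{ji}=4\cos^2(\pi/k_{ij})$ for an integer $k_{ij}\ge 2$. Put $m_{ij}=\infty$ in the first case and $m_{ij}=k_{ij}$ in the second, and let $W$ be the Coxeter group with generators $s_i$ $(i\in I)$ and relations $s_i^2=1$ and $(s_is_j)^{m_{ij}}=1$ for $i\ne j$, $m_{ij}<\infty$; let $\ell$ be its length function. Let $V$ be the real vector space with basis $(\alpha_i)_{i\in I}$ and let $B$ be the bilinear form on $V$ with $B(\alpha_i,\alpha_j)=\frac12 a_{ij}$. Then $W$ acts linearly on $V$ by $s_i.v=v-2B(\alpha_i,v)\alpha_i$. Let $\Phi=\Phi_A=\{w.\alpha_i : w\in W,\ i\in I\}$, and let $\Phi^+$ (resp. $\Phi^-$) be the set of elements of $\Phi$ all of whose coordinates in the basis $(\alpha_i)$ are nonnegative (resp. nonpositive). For $\alpha\in\Phi$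 let $\mathfrak S_A(\alpha)=\{K\alpha: K\in\mathbb R\}\cap\Phi^+$, and for $w\in W$ let $N(w)=\{\alpha\in\Phi^+ : w.\alpha\in\Phi^-\}$. An ON-path is a sequence $[i_0,\dots,i_q]$ $(q\ge 0)$ in $I$ whose consecutive members are distinct with $m_{i_ri_{r+1}}$ finite and odd; it is an ON-cycle if $i_q=i_0$. For such consecutive members set $K_{ji}=\frac{-a_{ji}}{2\cos(\pi/m_{ij})}$. The matrix $A$ is unital ON-cyclic if $K_{i_qi_{q-1}}\cdots K_{i_1i_0}=1$ for every ON-cycle $[i_0,\dots,i_q]$, and ON-connected if $I\neq\emptyset$ and any two members of $I$ are joined by an ON-path. For $A$ ON-connected and unital ON-cyclic, $f_A$ denotes the number $|\mathfrak S_A(\alpha_x)|$, which is finite and the same for all $x\in I$. An ON-connected component of $A$ is the submatrix $A'=(a_{ij})_{i,j\in I'}$ on a maximal set $I'\subseteq I$ of indices that are pairwise joined by ON-paths. It is itself an E-generalized Cartan matrix, so that (when it is unital ON-cyclic) $f_{A'}$ is defined, from the root system $\Phi_{A'}$. For $J\subseteq I$, let $\mathfrak C(J)$ be the set of ON-connected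 components of $A$ whose index set meets $J$. **Theorem 3.9.** Let $w\in W$ with $p=\ell(w)>0$. (1) The following are equivalent: (a) $N(w)$ is finite; (b) $w$ has a reduced expression $s_{i_1}\cdots s_{i_p}$ for which $\mathfrak S_A(\alpha_{i_q})$ is finite for all $1\le q\le p$; (c) every reduced expression $s_{i_1}\cdots s_{i_p}$ for $w$ has $\mathfrak S_A(\alpha_{i_q})$ finite for all $1\le q\le p$. (2) Suppose $N(w)$ is finite, let $w=s_{i_1}\cdots s_{i_p}$ be a reduced expression, and let $J=\{i_1,\dots,i_p\}$. Then every component $A'\in\mathfrak C(J)$ is unital ON-cyclic, so that $f_{A'}$ is defined (the sets $\mathfrak S_{A'}(\alpha_x)$, for $x$ in the index set of $A'$, are finite of the common cardinality $f_{A'}$). If $f_1$ is the minimum and $f_2$ the maximum of the set $\{f_{A'} : A'\in\mathfrak C(J)\}$, then $$f_1\,\ell(w)\le |N(w)|\le f_2\,\ell(w).$$ -/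

import Mathlib

noncomputable section

open Module

/-- An E-generalized Cartan matrix with rows and columns indexed by `I`. -/
structure EGCM (I : Type*) where
  /-- The entries `a i j` of the matrix. -/
  a : Matrix I I ℝ
  diag : ∀ i, a i i = 2
  nonpos : ∀ i j, i ≠ j → a i j ≤ 0
  ne_zero_symm : ∀ i j, a i j ≠ 0 → a j i ≠ 0
  prod_entries : ∀ i j, i ≠ j →
    4 ≤ a i j * a j i ∨ ∃ k : ℕ, 2 ≤ k ∧ a i j * a j i = 4 * Real.cos (Real.pi / k) ^ 2

namespace EGCM

variable {I : Type*} (A : EGCM I)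

open Classical in
/-- The exponents `m i j` of the associated Coxeter group, where `0` encodes `∞` (this is the
convention of `CoxeterMatrix`). For `i ≠ j` there is at most one `k ≥ 2` with
`a i j * a j i = 4 cos² (π / k)`, and there is none when `a i j * a j i ≥ 4`; in the latter case
the infimum below is that of the empty set of natural numbers, which is `0`. -/
def m (i j : I) : ℕ :=
  if i = j then 1
  else sInf {k : ℕ | 2 ≤ k ∧ A.a i j * A.a j i = 4 * Real.cos (Real.pi / k) ^ 2}

lemma m_self (i : I) : A.m i i = 1 := by simp [m]

lemma m_symm (i j : I) : A.m i j = A.m j i := by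
  by_cases h : i = j
  · rw [h]
  · simp only [m, h, Ne.symm h, if_false, mul_comm (A.a i j)]

lemma m_spec {i j : I} (h : i ≠ j) (h0 : A.m i j ≠ 0) :
    2 ≤ A.m i j ∧ A.a i j * A.a j i = 4 * Real.cos (Real.pi / (A.m i j : ℕ)) ^ 2 := by
  simp only [m, h, if_false] at h0 ⊢
  exact Nat.sInf_mem (Nat.nonempty_of_sInf_eq_succ (Nat.succ_pred h0).symm)

/-- The Coxeter matrix `(m i j)`. -/
def coxeterMatrix : CoxeterMatrix I where
  M := Matrix.of A.m
  isSymm := Matrix.IsSymm.ext fun i j => A.m_symm j i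
  diagonal := A.m_self
  off_diagonal i j h h1 := by
    have h1 : A.m i j = 1 := h1
    have := (A.m_spec h (by omega)).1
    omega

/-- The associated Coxeter group `W`. -/
abbrev W : Type _ := A.coxeterMatrix.Group

/-- The Coxeter system `(W, (s i))`, which carries the length function and reduced words. -/
abbrev cs : CoxeterSystem A.coxeterMatrix A.W := A.coxeterMatrix.toCoxeterSystem

/-- The real vector space `V` freely generated by the simple roots. -/
abbrev V (_A : EGCM I) : Type _ := I →₀ ℝ

/-- The simple roots as a basis of `V`. -/
abbrev simpleBasis : Basis I ℝ A.V := Finsupp.basisSingleOne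

/-- The simple root `α i`. -/
def simpleRoot (i : I) : A.V := A.simpleBasis i

/-- The (possibly asymmetric) bilinear form with `B (α i) (α j) = a i j / 2`. -/
def form : A.V →ₗ[ℝ] A.V →ₗ[ℝ] ℝ :=
  A.simpleBasis.constr ℝ fun i => A.simpleBasis.constr ℝ fun j => (1 / 2 : ℝ) * A.a i j

lemma form_simpleRoot (i j : I) :
    A.form (A.simpleRoot i) (A.simpleRoot j) = (1 / 2 : ℝ) * A.a i j := by
  simp only [form, simpleRoot, Basis.constr_basis]

/-- The linear form `v ↦ 2 B(α i, v)`. -/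
def coroot (i : I) : Dual ℝ A.V := (2 : ℝ) • A.form (A.simpleRoot i)

lemma coroot_simpleRoot (i j : I) : A.coroot i (A.simpleRoot j) = A.a i j := by
  simp only [coroot, LinearMap.smul_apply, form_simpleRoot, smul_eq_mul]
  ring

lemma coroot_self (i : I) : A.coroot i (A.simpleRoot i) = 2 := by
  rw [coroot_simpleRoot, A.diag]

/-- The reflection `S i : v ↦ v - 2 B(α i, v) α i`, as an element of `GL(V)`. -/
def reflection (i : I) : A.V ≃ₗ[ℝ] A.V := Module.reflection (A.coroot_self i)

lemma reflection_apply (i : I) (v : A.V) :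
    A.reflection i v = v - (2 * A.form (A.simpleRoot i) v) • A.simpleRoot i := by
  simp [reflection, Module.reflection_apply, coroot]

/-- The order relations hold for the reflections, so that they define a representation of `W`. -/
lemma isLiftable : A.coxeterMatrix.IsLiftable A.reflection := by
  intro i j
  change (A.reflection i * A.reflection j) ^ A.m i j = 1
  by_cases hij : i = j
  · subst hij
    rw [m_self, pow_one]
    ext1 v
    exact Module.involutive_reflection (A.coroot_self i) v
  by_cases h0 : A.m i j = 0
  · rw [h0, pow_zero]
  obtain ⟨h2, hk⟩ := A.m_spec hij h0
  rcases h2.eq_or_lt with h2 | h3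
  · -- the two reflections commute
    rw [← h2] at hk ⊢
    have hprod : A.a i j * A.a j i = 0 := by rw [hk]; simp
    have hz : A.a i j = 0 ∧ A.a j i = 0 := by
      by_cases h : A.a i j = 0
      · refine ⟨h, ?_⟩
        by_contra h'
        exact A.ne_zero_symm j i h' h
      · exact absurd hprod (mul_ne_zero h (A.ne_zero_symm i j h))
    ext1 v
    simp only [reflection, pow_two, LinearEquiv.mul_apply, Module.reflection_apply, map_sub,
      map_smul, coroot_simpleRoot, hz, A.diag, LinearEquiv.coe_one, id_eq]
    module
  · set k := A.m i j with hkdef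
    have hkpos : (0 : ℝ) < k := by positivity
    have hk3 : (3 : ℝ) ≤ k := by exact_mod_cast h3
    set φ : ℝ := 2 * (Real.pi / k) with hφ
    have hkφ : (k : ℝ) * φ = 2 * Real.pi := by rw [hφ]; field_simp
    have hs : Real.sin φ ≠ 0 := by
      apply ne_of_gt
      apply Real.sin_pos_of_pos_of_lt_pi
      · have := Real.pi_pos; positivity
      · have := Real.pi_pos; nlinarith
    have ht : (2 * Real.cos φ) =
        A.coroot i (A.simpleRoot j) * A.coroot j (A.simpleRoot i) - 2 := by
      rw [coroot_simpleRoot, coroot_simpleRoot, hk, hφ, Real.cos_two_mul]; ring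
    have hS (n : ℤ) := Polynomial.Chebyshev.S_two_mul_real_cos φ n
    have c1 : ∀ n : ℤ, (2 * (n : ℝ) + 2 = k) →
        (Polynomial.Chebyshev.S ℝ n).eval (2 * Real.cos φ) = 0 := by
      intro n hn
      have h := hS n
      have : ((n : ℝ) + 1) * φ = Real.pi := by
        have : (2 * (n : ℝ) + 2) * φ = 2 * Real.pi := by rw [hn, hkφ]
        linarith
      rw [this, Real.sin_pi] at h
      exact (mul_eq_zero.mp h).resolve_right hs
    have c2 : ∀ n l : ℤ, ((n : ℝ) + l + 2 = k) →
        (Polynomial.Chebyshev.S ℝ n).eval (2 * Real.cos φ) +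
          (Polynomial.Chebyshev.S ℝ l).eval (2 * Real.cos φ) = 0 := by
      intro n l hn
      have h : ((Polynomial.Chebyshev.S ℝ n).eval (2 * Real.cos φ) +
          (Polynomial.Chebyshev.S ℝ l).eval (2 * Real.cos φ)) * Real.sin φ = 0 := by
        rw [add_mul, hS, hS]
        have : ((n : ℝ) + 1) * φ = 2 * Real.pi - ((l : ℝ) + 1) * φ := by
          rw [← hkφ, ← hn]; ring
        rw [this, Real.sin_two_pi_sub]; ring
      exact (mul_eq_zero.mp h).resolve_right hs
    ext1 v
    simp only [reflection]
    rw [Module.reflection_mul_reflection_pow_apply _ _ k v _ ht]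
    obtain ⟨q, hq | hq⟩ := Nat.even_or_odd' k
    · have e1 : ((k : ℤ) - 2) / 2 = q - 1 := by omega
      have e2 : ((k : ℤ) - 1) / 2 = q - 1 := by omega
      have z : (Polynomial.Chebyshev.S ℝ ((q : ℤ) - 1)).eval (2 * Real.cos φ) = 0 :=
        c1 _ (by rw [hq]; push_cast; ring)
      simp [e1, e2, z]
    · have e1 : ((k : ℤ) - 2) / 2 = q - 1 := by omega
      have e2 : ((k : ℤ) - 1) / 2 = q := by omega
      have e3 : ((k : ℤ) - 3) / 2 = q - 1 := by omega
      have e4 : (k : ℤ) / 2 = q := by omega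
      have z := c2 (q : ℤ) ((q : ℤ) - 1) (by rw [hq]; push_cast; ring)
      simp [e1, e2, e3, e4, z]

/-- The geometric representation `σ : W → GL(V)`, determined by `σ (s i) = S i`. -/
def rep : A.W →* (A.V ≃ₗ[ℝ] A.V) := A.cs.lift ⟨A.reflection, A.isLiftable⟩

lemma rep_simple (i : I) : A.rep (A.cs.simple i) = A.reflection i :=
  A.cs.lift_apply_simple A.isLiftable i

/-- The root system `Φ`. -/
def roots : Set A.V := {v | ∃ (w : A.W) (i : I), v = A.rep w (A.simpleRoot i)}

/-- The positive roots `Φ⁺`: the roots all of whose coordinates are nonnegative. -/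
def posRoots : Set A.V := {v ∈ A.roots | ∀ i, 0 ≤ A.simpleBasis.repr v i}

/-- The negative roots `Φ⁻`: the roots all of whose coordinates are nonpositive. -/
def negRoots : Set A.V := {v ∈ A.roots | ∀ i, A.simpleBasis.repr v i ≤ 0}

/-- `𝔖(α)`: the positive roots that are real multiples of `α`. -/
def multiples (α : A.V) : Set A.V := {β | ∃ K : ℝ, β = K • α} ∩ A.posRoots

/-- `N(w)`: the positive roots that `w` sends to negative roots. -/
def N (w : A.W) : Set A.V := {α ∈ A.posRoots | A.rep w α ∈ A.negRoots}

/-- The graph whose edges join the odd neighbors: distinct `i`, `j` with `m i j` (finite and) odd.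
The ON-paths are the walks of this graph, the ON-cycles its closed walks. -/
def onGraph : SimpleGraph I where
  Adj i j := i ≠ j ∧ Odd (A.m i j)
  symm := ⟨fun i j h => ⟨h.1.symm, A.m_symm i j ▸ h.2⟩⟩
  loopless := ⟨fun _ h => h.1 rfl⟩

/-- The factor `K j i = -a j i / (2 cos (π / m i j))` of the step from `i` to `j`. -/
def K (j i : I) : ℝ := -A.a j i / (2 * Real.cos (Real.pi / A.m i j))

/-- The product `Π` of the factors along an ON-path. -/
def pathProd {i j : I} (p : A.onGraph.Walk i j) : ℝ := (p.darts.map fun d => A.K d.snd d.fst).prod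

/-- Every ON-cycle has product `1`. -/
def UnitalONCyclic : Prop := ∀ (i : I) (c : A.onGraph.Walk i i), A.pathProd c = 1

/-- Any two nodes are joined by an ON-path (and there is a node). -/
def ONConnected : Prop := A.onGraph.Connected

/-- The E-generalized Cartan matrix formed by the rows and columns indexed by `s`. -/
def restrict (s : Set I) : EGCM s where
  a := A.a.submatrix (↑) (↑)
  diag i := A.diag i
  nonpos i j h := A.nonpos i j (Subtype.coe_injective.ne h)
  ne_zero_symm i j := A.ne_zero_symm i j
  prod_entries i j h := A.prod_entries i j (Subtype.coe_injective.ne h)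

/-- The invariant `f`: the number `|𝔖(α x)|` for any given node `x`. It is meant for an
ON-connected and unital ON-cyclic `A`, where this number is finite and does not depend on `x`. -/
def f [Nonempty I] : ℕ := (A.multiples (A.simpleRoot (Classical.arbitrary I))).ncard

/-- The E-generalized Cartan matrix `A'` of an ON-connected component `(Γ', A')`. -/
abbrev component (C : A.onGraph.ConnectedComponent) : EGCM C.supp := A.restrict C.supp

instance (C : A.onGraph.ConnectedComponent) : Nonempty C.supp := C.nonempty_supp.to_subtype

/-- `ℭ(J)`: the ON-connected components that contain some node from `J`. -/
def componentsMeeting (J : Set I) : Set A.onGraph.ConnectedComponent :=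
  {C | ∃ x ∈ J, x ∈ C.supp}

/-- The word `ω` is a reduced expression for `w`. -/
def IsReducedExpr (w : A.W) (ω : List I) : Prop := A.cs.wordProd ω = w ∧ A.cs.IsReduced ω

end EGCM

end

/-! Everything rests on a sign rule: `w.α i` has nonnegative coordinates if `ℓ(w s_i) > ℓ(w)` and
nonpositive ones otherwise (`rep_simpleRoot_nonneg`, `rep_simpleRoot_nonpos`). It is reduced to rank
two by splitting the longest alternating word in two letters off the right end of `w`; there the
coefficients are quotients of sines, or come from a recursion that preserves positivity if `a i j *
a j i ≥ 4` (`dihedral_trichotomy`).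

The rule implies that `s_i` permutes the positive roots outside `𝔖(α i)`. Hence, when `w s_i` is
longer than `w`, `N(w s_i)` is the disjoint union of `𝔖(α i)` and `s_i N(w)`, and `|N(w)|` is the
sum of the `|𝔖(α i)|` over the letters of any reduced word (`encard_N_wordProd`). Part (1) follows.

For (2), the same factorization identifies `𝔖(α x)`. In rank two a simple root reaches a multiple of
the other one exactly at the end of an alternating word of length `m - 1` with `m` odd, and the
factor is `K`. So `𝔖(α x)` corresponds to the set of products along ON-paths ending in `x`
(`multiples_eq_image`). The size of that set is constant on an ON-component and intrinsic to it, and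
it is infinite once a cycle has product different from 1. Each summand is therefore some `f` of a
component and lies between `f₁` and `f₂`. -/

open Module CoxeterSystem

namespace EGCM

variable {I : Type*} (A : EGCM I)

/-! ### Roots of rank two -/

/-- The coefficients which occur when two reflections are applied alternately to a simple root;
`t` is the product `a i j * a j i`. -/
noncomputable def dihedralCoeff (t : ℝ) : ℕ → ℝ × ℝ
  | 0 => (1, 0)
  | n + 1 =>
    (t * ((dihedralCoeff t n).1 - (dihedralCoeff t n).2) - (dihedralCoeff t n).1,
      (dihedralCoeff t n).1 - (dihedralCoeff t n).2)

/-- The recursion is `sin (x + θ) + sin (x - θ) = 2 cos θ sin x`. Denominators are cleared because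
`cos θ` vanishes when `m = 2`. -/
lemma dihedralCoeff_trig (θ : ℝ) (n : ℕ) :
    (dihedralCoeff (4 * Real.cos θ ^ 2) n).1 * Real.sin θ = Real.sin ((2 * n + 1) * θ) ∧
      2 * Real.cos θ * Real.sin θ * (dihedralCoeff (4 * Real.cos θ ^ 2) n).2 =
        Real.sin (2 * n * θ) := by
  induction n with
  | zero => simp [dihedralCoeff]
  | succ n ih =>
    obtain ⟨h1, h2⟩ := ih
    set P := (dihedralCoeff (4 * Real.cos θ ^ 2) n).1
    set R := (dihedralCoeff (4 * Real.cos θ ^ 2) n).2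
    have e1 : Real.sin (2 * (n + 1 : ℕ) * θ) =
        2 * Real.cos θ * Real.sin ((2 * n + 1) * θ) - Real.sin (2 * n * θ) := by
      rw [show 2 * ((n + 1 : ℕ) : ℝ) * θ = (2 * n + 1) * θ + θ by push_cast; ring,
        show 2 * (n : ℝ) * θ = (2 * n + 1) * θ - θ by ring, Real.sin_add, Real.sin_sub]
      ring
    have e2 : Real.sin ((2 * (n + 1 : ℕ) + 1) * θ) =
        2 * Real.cos θ * Real.sin (2 * (n + 1 : ℕ) * θ) - Real.sin ((2 * n + 1) * θ) := by
      rw [show (2 * ((n + 1 : ℕ) : ℝ) + 1) * θ = 2 * (n + 1 : ℕ) * θ + θ by ring,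
        show (2 * (n : ℝ) + 1) * θ = 2 * (n + 1 : ℕ) * θ - θ by push_cast; ring,
        Real.sin_add, Real.sin_sub]
      ring
    refine ⟨?_, ?_⟩
    · rw [e2, e1, ← h1, ← h2]
      simp only [dihedralCoeff]
      ring
    · rw [e1, ← h1, ← h2]
      simp only [dihedralCoeff]
      ring

/-- The inequality `2R ≤ P` between the two coefficients is what the recursion preserves for `t ≥
4`. -/
lemma dihedralCoeff_of_four_le {t : ℝ} (ht : 4 ≤ t) (n : ℕ) :
    0 ≤ (dihedralCoeff t n).2 ∧ 2 * (dihedralCoeff t n).2 ≤ (dihedralCoeff t n).1 ∧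
      0 < (dihedralCoeff t n).1 ∧ 0 < (dihedralCoeff t (n + 1)).2 := by
  induction n with
  | zero => simp [dihedralCoeff]
  | succ n ih =>
    obtain ⟨h1, h2, h3, h4⟩ := ih
    simp only [dihedralCoeff] at h4 ⊢
    set P := (dihedralCoeff t n).1
    set R := (dihedralCoeff t n).2
    have h5 : 4 * (P - R) ≤ t * (P - R) := mul_le_mul_of_nonneg_right ht h4.le
    refine ⟨h4.le, ?_, ?_, ?_⟩ <;> linarith

lemma simpleRoot_eq (i : I) : A.simpleRoot i = Finsupp.single i 1 := by
  simp [simpleRoot]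

lemma reflection_simpleRoot (i j : I) :
    A.reflection i (A.simpleRoot j) = A.simpleRoot j - A.a i j • A.simpleRoot i := by
  rw [reflection, Module.reflection_apply, coroot_simpleRoot]

lemma reflection_simpleRoot_self (i : I) :
    A.reflection i (A.simpleRoot i) = -A.simpleRoot i := by
  rw [reflection_simpleRoot, A.diag]
  module

/-- With `-a j i` split off, the coefficients depend only on the product `a i j * a j i`. Each
reflection changes one coordinate, so an odd word mixes the indices `n` and `n + 1`. -/
lemma rep_alternatingWord (i j : I) (n : ℕ) :
    A.rep (A.cs.wordProd (alternatingWord i j (2 * n))) (A.simpleRoot i) =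
        (dihedralCoeff (A.a i j * A.a j i) n).1 • A.simpleRoot i +
          (-A.a j i * (dihedralCoeff (A.a i j * A.a j i) n).2) • A.simpleRoot j ∧
      A.rep (A.cs.wordProd (alternatingWord i j (2 * n + 1))) (A.simpleRoot i) =
        (dihedralCoeff (A.a i j * A.a j i) n).1 • A.simpleRoot i +
          (-A.a j i * (dihedralCoeff (A.a i j * A.a j i) (n + 1)).2) • A.simpleRoot j := by
  have step : ∀ n : ℕ,
      A.rep (A.cs.wordProd (alternatingWord i j (2 * n))) (A.simpleRoot i) =
        (dihedralCoeff (A.a i j * A.a j i) n).1 • A.simpleRoot i +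
          (-A.a j i * (dihedralCoeff (A.a i j * A.a j i) n).2) • A.simpleRoot j →
      A.rep (A.cs.wordProd (alternatingWord i j (2 * n + 1))) (A.simpleRoot i) =
        (dihedralCoeff (A.a i j * A.a j i) n).1 • A.simpleRoot i +
          (-A.a j i * (dihedralCoeff (A.a i j * A.a j i) (n + 1)).2) • A.simpleRoot j := by
    intro n h
    rw [alternatingWord_succ', if_pos (even_two_mul n), wordProd_cons, map_mul,
      LinearEquiv.mul_apply, h, rep_simple, map_add, map_smul, map_smul,
      reflection_simpleRoot_self, reflection_simpleRoot]
    simp only [dihedralCoeff]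
    module
  have even : A.rep (A.cs.wordProd (alternatingWord i j (2 * n))) (A.simpleRoot i) =
        (dihedralCoeff (A.a i j * A.a j i) n).1 • A.simpleRoot i +
          (-A.a j i * (dihedralCoeff (A.a i j * A.a j i) n).2) • A.simpleRoot j := by
    induction n with
    | zero => simp [dihedralCoeff, alternatingWord]
    | succ n ih =>
      rw [show 2 * (n + 1) = 2 * n + 1 + 1 by ring, alternatingWord_succ',
        if_neg (by simp), wordProd_cons, map_mul,
        LinearEquiv.mul_apply, step n ih, rep_simple, map_add, map_smul, map_smul,
        reflection_simpleRoot_self, reflection_simpleRoot]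
      simp only [dihedralCoeff]
      module
  exact ⟨even, step n even⟩

lemma four_le_of_m_eq_zero {i j : I} (hij : i ≠ j) (h0 : A.m i j = 0) :
    4 ≤ A.a i j * A.a j i := by
  refine (A.prod_entries i j hij).resolve_right ?_
  rintro ⟨k, hk⟩
  simp only [m, hij, if_false] at h0
  have := Nat.sInf_mem (s := {k : ℕ | 2 ≤ k ∧
    A.a i j * A.a j i = 4 * Real.cos (Real.pi / k) ^ 2}) ⟨k, hk⟩
  rw [h0] at this
  exact absurd this.1 (by omega)

lemma cos_pi_div_pos {k : ℕ} (hk : 3 ≤ k) : 0 < Real.cos (Real.pi / k) := by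
  have hk3 : (3 : ℝ) ≤ k := by exact_mod_cast hk
  have hpi := Real.pi_pos
  apply Real.cos_pos_of_mem_Ioo
  constructor
  · have : 0 < Real.pi / k := by positivity
    linarith
  · exact div_lt_div_of_pos_left hpi (by norm_num) (by linarith)

lemma neg_entry_pos {i j : I} (hij : i ≠ j) (hm : 3 ≤ A.m i j) : 0 < -A.a j i := by
  have h := (A.m_spec hij (by omega)).2
  have hc := cos_pi_div_pos hm
  have hne : A.a j i ≠ 0 := by
    intro h0
    rw [h0, mul_zero] at h
    have : 0 < 4 * Real.cos (Real.pi / (A.m i j : ℕ)) ^ 2 := by positivity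
    linarith
  have := lt_of_le_of_ne (A.nonpos j i hij.symm) hne
  linarith

lemma K_pos {i j : I} (hij : i ≠ j) (hm : Odd (A.m i j)) : 0 < A.K j i := by
  have h2 := (A.m_spec hij hm.pos.ne').1
  have h3 : 3 ≤ A.m i j := by
    rcases hm with ⟨q, hq⟩
    omega
  have := A.neg_entry_pos hij h3
  rw [K]
  have := cos_pi_div_pos h3
  positivity

/-- Applying fewer than `m i j` alternating reflections to `α i` gives a root with positive
coordinates, unless it is `α i` itself or a multiple of `α j`. -/
theorem dihedral_trichotomy {i j : I} (hij : i ≠ j) {k : ℕ} (hk : A.m i j = 0 ∨ k < A.m i j) :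
    ∃ p q : ℝ, A.rep (A.cs.wordProd (alternatingWord i j k)) (A.simpleRoot i) =
        p • A.simpleRoot i + q • A.simpleRoot j ∧
      ((¬(k + 1 = A.m i j ∧ Odd (A.m i j)) ∧ ((0 < p ∧ 0 < q) ∨ (p = 1 ∧ q = 0))) ∨
        (p = 0 ∧ k + 1 = A.m i j ∧ Odd (A.m i j) ∧ q = A.K j i)) := by
  obtain ⟨n, hn⟩ := Nat.even_or_odd' k
  by_cases h0 : A.m i j = 0
  · have ht := A.four_le_of_m_eq_zero hij h0
    have hb : 0 < -A.a j i := by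
      have hne : A.a j i ≠ 0 := by
        intro h
        rw [h, mul_zero] at ht
        linarith
      have := lt_of_le_of_ne (A.nonpos j i hij.symm) hne
      linarith
    obtain ⟨-, -, h3, h4⟩ := dihedralCoeff_of_four_le ht n
    rcases hn with rfl | rfl
    · refine ⟨_, _, (A.rep_alternatingWord i j n).1, ?_⟩
      refine Or.inl ⟨by omega, ?_⟩
      rcases n with _ | n
      · right
        simp [dihedralCoeff]
      · left
        exact ⟨h3, mul_pos hb (dihedralCoeff_of_four_le ht n).2.2.2⟩
    · exact ⟨_, _, (A.rep_alternatingWord i j n).2,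
        Or.inl ⟨by omega, Or.inl ⟨h3, mul_pos hb h4⟩⟩⟩
  · replace hk := hk.resolve_left h0
    obtain ⟨hm2, ht⟩ := A.m_spec hij h0
    set M := A.m i j with hM
    set θ : ℝ := Real.pi / M with hθ
    have hpi := Real.pi_pos
    have hM0 : (0 : ℝ) < M := by positivity
    have hMθ : M * θ = Real.pi := by rw [hθ]; field_simp
    have hθ0 : 0 < θ := by positivity
    have sin_pos : ∀ x : ℕ, 0 < x → x < M → 0 < Real.sin (x * θ) := by
      intro x hx hxM
      apply Real.sin_pos_of_pos_of_lt_pi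
      · positivity
      · rw [← hMθ]
        exact mul_lt_mul_of_pos_right (by exact_mod_cast hxM) hθ0
    have hsin : 0 < Real.sin θ := by simpa using sin_pos 1 one_pos (by omega)
    have sin_last : ∀ x : ℕ, x + 1 = M → Real.sin (x * θ) = Real.sin θ := by
      intro x hx
      rw [← Real.sin_pi_sub]
      congr 1
      rw [← hMθ, ← hx]
      push_cast
      ring
    have sin_end : ∀ x : ℕ, x = M → Real.sin (x * θ) = 0 := by
      rintro x rfl
      rw [hMθ, Real.sin_pi]
    have hP : ∀ n : ℕ, (dihedralCoeff (A.a i j * A.a j i) n).1 * Real.sin θ =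
        Real.sin ((2 * n + 1 : ℕ) * θ) := by
      intro n
      rw [ht, (dihedralCoeff_trig θ n).1]
      push_cast
      ring_nf
    have hR : ∀ n : ℕ, 2 * Real.cos θ * Real.sin θ *
        (dihedralCoeff (A.a i j * A.a j i) n).2 = Real.sin ((2 * n : ℕ) * θ) := by
      intro n
      rw [ht, (dihedralCoeff_trig θ n).2]
      push_cast
      ring_nf
    have Ppos : ∀ n : ℕ, 2 * n + 1 < M → 0 < (dihedralCoeff (A.a i j * A.a j i) n).1 := by
      intro n h
      have := sin_pos _ (by omega) h
      rw [← hP] at this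
      exact pos_of_mul_pos_left this hsin.le
    have Qpos : ∀ n : ℕ, 0 < n → 2 * n < M →
        0 < -A.a j i * (dihedralCoeff (A.a i j * A.a j i) n).2 := by
      intro n h0 h
      have := sin_pos _ (by omega) h
      rw [← hR] at this
      have hc : 0 < Real.cos θ := cos_pi_div_pos (by omega)
      exact mul_pos (A.neg_entry_pos hij (by omega))
        (pos_of_mul_pos_right this (by positivity))
    rcases hn with rfl | rfl
    · refine ⟨_, _, (A.rep_alternatingWord i j n).1, ?_⟩
      rcases Nat.eq_zero_or_pos n with rfl | hn
      · refine Or.inl ⟨by omega, Or.inr ?_⟩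
        simp [dihedralCoeff]
      · rcases Nat.lt_or_ge (2 * n + 1) M with h | h
        · exact Or.inl ⟨by omega, Or.inl ⟨Ppos n h, Qpos n hn hk⟩⟩
        -- Here `k = m - 1` with `m` odd: the first sine is `sin π = 0`, the second equals `sin θ`,
        -- and what remains is `K j i`.
        · right
          have hlast : 2 * n + 1 = M := by omega
          have hc : 0 < Real.cos θ := cos_pi_div_pos (by omega)
          refine ⟨?_, hlast, ⟨n, hlast.symm⟩, ?_⟩
          · have := hP n
            rw [sin_end _ hlast] at this
            exact (mul_eq_zero.mp this).resolve_right hsin.ne'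
          · have := hR n
            rw [sin_last _ hlast] at this
            rw [K, ← hM, ← hθ, eq_div_iff (by positivity)]
            have h1 : 2 * Real.cos θ * (dihedralCoeff (A.a i j * A.a j i) n).2 = 1 :=
              mul_right_cancel₀ hsin.ne' (by linarith)
            linear_combination (-A.a j i) * h1
    · refine ⟨_, _, (A.rep_alternatingWord i j n).2, ?_⟩
      refine Or.inl ⟨by rintro ⟨h, r, hr⟩; omega, ?_⟩
      rcases Nat.lt_or_ge (2 * (n + 1)) M with h | h
      · exact Or.inl ⟨Ppos n (by omega), Qpos (n + 1) n.succ_pos h⟩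
      -- Here `k = m - 1` with `m` even, and the root has returned to `α i`.
      · right
        have hlast : 2 * (n + 1) = M := by omega
        refine ⟨?_, ?_⟩
        · have := hP n
          rw [sin_last _ (by omega)] at this
          exact mul_right_cancel₀ hsin.ne' (by linarith)
        -- For `m = 2` the cosine vanishes and cannot be cancelled, but then `a j i` is itself zero.
        · rcases hm2.eq_or_lt with h2 | h3
          · have hz : A.a j i = 0 := by
              by_contra h
              have h' := A.ne_zero_symm j i h
              rw [hθ, ← h2] at ht
              apply mul_ne_zero h' h
              rw [ht]
              simp
            simp [hz]
          · have hc : 0 < Real.cos θ := cos_pi_div_pos (by omega)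
            have := hR (n + 1)
            rw [sin_end _ hlast] at this
            rw [(mul_eq_zero.mp this).resolve_left (by positivity), mul_zero]

/-! ### Positivity of roots -/

/-- Splitting off the longest alternating word in two letters `i` and `j` from the right. -/
theorem exists_alternatingWord_factor {w : A.W} {i j : I} (hi : ¬A.cs.IsRightDescent w i)
    (hj : A.cs.IsRightDescent w j) :
    ∃ (v : A.W) (k : ℕ), w = v * A.cs.wordProd (alternatingWord i j k) ∧
      A.cs.length v < A.cs.length w ∧ ¬A.cs.IsRightDescent v i ∧ ¬A.cs.IsRightDescent v j ∧
      (A.m i j = 0 ∨ k < A.m i j) := by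
  let P : ℕ → Prop := fun k => ∃ v : A.W, w = v * A.cs.wordProd (alternatingWord i j k) ∧
    A.cs.length w = A.cs.length v + k
  have h1 : P 1 := by
    refine ⟨w * A.cs.simple j, ?_, ?_⟩
    · rw [show alternatingWord i j 1 = [j] from rfl, wordProd_singleton,
        simple_mul_simple_cancel_right]
    rw [A.cs.isRightDescent_iff] at hj
    exact hj.symm
  -- A last such `k` exists because `P k` forces `k ≤ ℓ(w)`.
  obtain ⟨k, hk1, hk, hk'⟩ : ∃ k, 1 ≤ k ∧ P k ∧ ¬P (k + 1) := by
    by_contra! h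
    have hall : ∀ k, 1 ≤ k → P k := fun k hk => Nat.le_induction h1 (fun n hn => h n hn) k hk
    obtain ⟨v, -, hv⟩ := hall (A.cs.length w + 1) (by omega)
    omega
  obtain ⟨v, hw, hl⟩ := hk
  have hnext : ¬A.cs.IsRightDescent v (if Even k then j else i) := by
    intro hd
    rw [A.cs.isRightDescent_iff] at hd
    refine hk' ⟨v * A.cs.simple (if Even k then j else i), ?_, by omega⟩
    rw [alternatingWord_succ', wordProd_cons, ← mul_assoc, simple_mul_simple_cancel_right]
    exact hw
  -- This letter is the first one of the split-off word; a descent would cancel it and write `w`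
  -- with two letters too few.
  have hprev : ¬A.cs.IsRightDescent v (if Even k then i else j) := by
    intro hd
    rw [A.cs.isRightDescent_iff] at hd
    obtain ⟨n, rfl⟩ : ∃ n, k = n + 1 := ⟨k - 1, by omega⟩
    have e : (if Even (n + 1) then i else j) = if Even n then j else i := by
      by_cases h : Even n <;> simp [h, Nat.even_add_one]
    rw [e] at hd
    have hw' : w = v * A.cs.simple (if Even n then j else i) *
        A.cs.wordProd (alternatingWord i j n) := by
      rw [hw, alternatingWord_succ', wordProd_cons, mul_assoc]
    have h2 := A.cs.length_mul_le (v * A.cs.simple (if Even n then j else i))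
      (A.cs.wordProd (alternatingWord i j n))
    rw [← hw'] at h2
    have h3 := A.cs.length_wordProd_le (alternatingWord i j n)
    rw [length_alternatingWord] at h3
    omega
  refine ⟨v, k, hw, by omega, ?_, ?_, ?_⟩
  · by_cases h : Even k
    · simpa [h] using hprev
    · simpa [h] using hnext
  · by_cases h : Even k
    · simpa [h] using hnext
    · simpa [h] using hprev
  -- As `i` is not a descent, `w s_i` has length `ℓ(v) + k + 1`, which forces the alternating word
  -- of length `k + 1 > m` to be reduced.
  · by_contra! hm
    have hred : ¬A.cs.IsReduced (alternatingWord j i (k + 1)) := by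
      apply A.cs.not_isReduced_alternatingWord
      · change A.m j i ≠ 0
        rw [A.m_symm]
        exact hm.1
      · change A.m j i < k + 1
        rw [A.m_symm]
        omega
    apply hred
    rw [A.cs.not_isRightDescent_iff] at hi
    have hwi : w * A.cs.simple i = v * A.cs.wordProd (alternatingWord j i (k + 1)) := by
      rw [alternatingWord_succ, wordProd_concat, hw, mul_assoc]
    have h2 := A.cs.length_mul_le v (A.cs.wordProd (alternatingWord j i (k + 1)))
    rw [← hwi] at h2
    have h3 := A.cs.length_wordProd_le (alternatingWord j i (k + 1))
    rw [length_alternatingWord] at h3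
    rw [CoxeterSystem.IsReduced, length_alternatingWord]
    omega

theorem rep_simpleRoot_nonneg (w : A.W) (i : I) (hi : ¬A.cs.IsRightDescent w i) (x : I) :
    0 ≤ A.rep w (A.simpleRoot i) x := by
  induction hn : A.cs.length w using Nat.strong_induction_on generalizing w i with
  | _ n ih =>
    subst hn
    by_cases hw : w = 1
    · subst hw
      rw [map_one, LinearEquiv.coe_one, id_eq, simpleRoot_eq]
      exact Finsupp.single_nonneg.2 zero_le_one x
    obtain ⟨j, hj⟩ := A.cs.exists_rightDescent_of_ne_one hw
    have hij : i ≠ j := by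
      rintro rfl
      exact hi hj
    obtain ⟨v, k, rfl, hl, hvi, hvj, hk⟩ := A.exists_alternatingWord_factor hi hj
    obtain ⟨p, q, he, hpq⟩ := A.dihedral_trichotomy hij hk
    rw [map_mul, LinearEquiv.mul_apply, he, map_add, map_smul, map_smul, Finsupp.add_apply,
      Finsupp.smul_apply, Finsupp.smul_apply, smul_eq_mul, smul_eq_mul]
    have h1 := ih _ hl v i hvi rfl
    have h2 := ih _ hl v j hvj rfl
    have hpq' : 0 ≤ p ∧ 0 ≤ q := by
      rcases hpq with ⟨-, ⟨hp, hq⟩ | ⟨rfl, rfl⟩⟩ | ⟨rfl, -, hm, rfl⟩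
      · exact ⟨hp.le, hq.le⟩
      · exact ⟨zero_le_one, le_rfl⟩
      · exact ⟨le_rfl, (A.K_pos hij hm).le⟩
    exact add_nonneg (mul_nonneg hpq'.1 h1) (mul_nonneg hpq'.2 h2)

lemma rep_mul_simple (w : A.W) (i : I) :
    A.rep (w * A.cs.simple i) (A.simpleRoot i) = -A.rep w (A.simpleRoot i) := by
  rw [map_mul, LinearEquiv.mul_apply, rep_simple, reflection_simpleRoot_self, map_neg]

theorem rep_simpleRoot_nonpos (w : A.W) (i : I) (hi : A.cs.IsRightDescent w i) (x : I) :
    A.rep w (A.simpleRoot i) x ≤ 0 := by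
  have h := A.rep_simpleRoot_nonneg (w * A.cs.simple i) i
    (A.cs.isRightDescent_iff_not_isRightDescent_mul.1 hi) x
  rw [rep_mul_simple, Finsupp.neg_apply] at h
  linarith

lemma mem_posRoots {v : A.V} : v ∈ A.posRoots ↔ v ∈ A.roots ∧ ∀ i, 0 ≤ v i := by
  simp [posRoots]

lemma mem_negRoots {v : A.V} : v ∈ A.negRoots ↔ v ∈ A.roots ∧ ∀ i, v i ≤ 0 := by
  simp [negRoots]

lemma simpleRoot_ne_zero (i : I) : A.simpleRoot i ≠ 0 := by
  simp [simpleRoot_eq]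

lemma ne_zero_of_mem_roots {v : A.V} (hv : v ∈ A.roots) : v ≠ 0 := by
  obtain ⟨w, i, rfl⟩ := hv
  exact (LinearEquiv.map_ne_zero_iff _).2 (A.simpleRoot_ne_zero i)

lemma mem_posRoots_or_mem_negRoots {v : A.V} (hv : v ∈ A.roots) :
    v ∈ A.posRoots ∨ v ∈ A.negRoots := by
  obtain ⟨w, i, rfl⟩ := id hv
  by_cases hi : A.cs.IsRightDescent w i
  · exact Or.inr (A.mem_negRoots.2 ⟨hv, A.rep_simpleRoot_nonpos w i hi⟩)
  · exact Or.inl (A.mem_posRoots.2 ⟨hv, A.rep_simpleRoot_nonneg w i hi⟩)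

lemma notMem_negRoots {v : A.V} (hv : v ∈ A.posRoots) : v ∉ A.negRoots := by
  intro h
  rw [mem_posRoots] at hv
  rw [mem_negRoots] at h
  exact A.ne_zero_of_mem_roots h.1 (Finsupp.ext fun i => le_antisymm (h.2 i) (hv.2 i))

lemma rep_mem_roots (w : A.W) {v : A.V} (hv : v ∈ A.roots) : A.rep w v ∈ A.roots := by
  obtain ⟨u, i, rfl⟩ := hv
  exact ⟨w * u, i, by rw [map_mul, LinearEquiv.mul_apply]⟩

lemma simpleRoot_mem_roots (i : I) : A.simpleRoot i ∈ A.roots := ⟨1, i, by simp⟩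

lemma mem_multiples {i : I} {v : A.V} :
    v ∈ A.multiples (A.simpleRoot i) ↔ ∃ c : ℝ, 0 < c ∧ v = c • A.simpleRoot i ∧ v ∈ A.roots := by
  constructor
  · rintro ⟨⟨c, rfl⟩, h⟩
    rw [mem_posRoots] at h
    refine ⟨c, lt_of_le_of_ne ?_ ?_, rfl, h.1⟩
    · simpa [simpleRoot_eq] using h.2 i
    · rintro rfl
      exact A.ne_zero_of_mem_roots h.1 (zero_smul _ _)
  · rintro ⟨c, hc, rfl, h⟩
    refine ⟨⟨c, rfl⟩, A.mem_posRoots.2 ⟨h, fun x => ?_⟩⟩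
    rw [Finsupp.smul_apply, simpleRoot_eq, smul_eq_mul]
    exact mul_nonneg hc.le (Finsupp.single_nonneg.2 zero_le_one x)

/-- The reflection changes only the coordinate at `i`, so if the image is negative, all other
coordinates of `v` vanish. -/
lemma reflection_mem_posRoots {i : I} {v : A.V} (hv : v ∈ A.posRoots)
    (hi : v ∉ A.multiples (A.simpleRoot i)) : A.reflection i v ∈ A.posRoots := by
  have hroot : A.reflection i v ∈ A.roots := by
    rw [← rep_simple]
    exact A.rep_mem_roots _ (A.mem_posRoots.1 hv).1
  refine (A.mem_posRoots_or_mem_negRoots hroot).resolve_right fun hneg => hi ⟨⟨v i, ?_⟩, hv⟩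
  rw [mem_negRoots] at hneg
  rw [mem_posRoots] at hv
  ext x
  by_cases hx : i = x
  · simp [simpleRoot_eq, hx]
  · have h1 := hneg.2 x
    have h2 := hv.2 x
    have h0 : A.simpleRoot i x = 0 := by rw [simpleRoot_eq, Finsupp.single_eq_of_ne' hx]
    rw [reflection_apply, Finsupp.sub_apply, Finsupp.smul_apply, h0, smul_zero, sub_zero] at h1
    rw [Finsupp.smul_apply, h0, smul_zero]
    exact le_antisymm h1 h2

lemma reflection_reflection (i : I) (v : A.V) : A.reflection i (A.reflection i v) = v :=
  Module.involutive_reflection (A.coroot_self i) v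

/-! ### The inversion sets -/

lemma notMem_multiples_of_mem_N {w : A.W} {i : I} (hi : ¬A.cs.IsRightDescent w i) {v : A.V}
    (hv : v ∈ A.N w) : v ∉ A.multiples (A.simpleRoot i) := by
  intro h
  obtain ⟨c, hc, rfl, h⟩ := A.mem_multiples.1 h
  refine A.notMem_negRoots (A.mem_posRoots.2 ⟨A.rep_mem_roots w h, fun x => ?_⟩) hv.2
  rw [map_smul, Finsupp.smul_apply, smul_eq_mul]
  exact mul_nonneg hc.le (A.rep_simpleRoot_nonneg w i hi x)

theorem N_mul_simple {w : A.W} {i : I} (hi : ¬A.cs.IsRightDescent w i) :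
    A.N (w * A.cs.simple i) = A.multiples (A.simpleRoot i) ∪ A.reflection i '' A.N w := by
  have hrep : ∀ v, A.rep (w * A.cs.simple i) v = A.rep w (A.reflection i v) := fun v => by
    rw [map_mul, LinearEquiv.mul_apply, rep_simple]
  ext v
  constructor
  · rintro ⟨hpos, hneg⟩
    by_cases hv : v ∈ A.multiples (A.simpleRoot i)
    · exact Or.inl hv
    · rw [hrep] at hneg
      exact Or.inr ⟨A.reflection i v, ⟨A.reflection_mem_posRoots hpos hv, hneg⟩,
        A.reflection_reflection i v⟩
  · rintro (hv | ⟨u, hu, rfl⟩)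
    · refine ⟨hv.2, ?_⟩
      obtain ⟨c, hc, rfl, h⟩ := A.mem_multiples.1 hv
      refine A.mem_negRoots.2 ⟨A.rep_mem_roots _ h, fun x => ?_⟩
      rw [map_smul, rep_mul_simple, Finsupp.smul_apply, Finsupp.neg_apply, smul_eq_mul]
      have := mul_nonneg hc.le (A.rep_simpleRoot_nonneg w i hi x)
      linarith
    · refine ⟨A.reflection_mem_posRoots hu.1 (A.notMem_multiples_of_mem_N hi hu), ?_⟩
      rw [hrep, reflection_reflection]
      exact hu.2

/-- The union is disjoint because `s_i` preserves the line of `α i`, which `N w` avoids. -/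
theorem encard_N_mul_simple {w : A.W} {i : I} (hi : ¬A.cs.IsRightDescent w i) :
    (A.N (w * A.cs.simple i)).encard =
      (A.multiples (A.simpleRoot i)).encard + (A.N w).encard := by
  rw [A.N_mul_simple hi, Set.encard_union_eq, (A.reflection i).injective.encard_image]
  rw [Set.disjoint_left]
  rintro _ hv ⟨u, hu, rfl⟩
  refine A.notMem_multiples_of_mem_N hi hu ?_
  obtain ⟨c, hc, h, -⟩ := A.mem_multiples.1 hv
  refine ⟨⟨-c, ?_⟩, hu.1⟩
  rw [← A.reflection_reflection i u, h, map_smul, reflection_simpleRoot_self, smul_neg, neg_smul]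

theorem N_one : A.N 1 = ∅ := by
  rw [Set.eq_empty_iff_forall_notMem]
  rintro v ⟨h1, h2⟩
  rw [map_one, LinearEquiv.coe_one, id_eq] at h2
  exact A.notMem_negRoots h1 h2

/-- The size of `N w` is the sum of the sizes of the sets of multiples along a reduced word. -/
theorem encard_N_wordProd {ω : List I} (hω : A.cs.IsReduced ω) :
    (A.N (A.cs.wordProd ω)).encard =
      (ω.map fun i => (A.multiples (A.simpleRoot i)).encard).sum := by
  induction ω using List.reverseRecOn with
  | nil => simp [N_one]
  | append_singleton ω i ih =>
    have hred : A.cs.IsReduced ω := by simpa using hω.take ω.length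
    rw [wordProd_append, wordProd_singleton, encard_N_mul_simple, ih hred]
    · simp [add_comm]
    · rw [A.cs.not_isRightDescent_iff, hred.eq]
      have := hω.eq
      rwa [wordProd_append, wordProd_singleton, List.length_append, List.length_singleton] at this

theorem finite_N_wordProd_iff {ω : List I} (hω : A.cs.IsReduced ω) :
    (A.N (A.cs.wordProd ω)).Finite ↔ ∀ i ∈ ω, (A.multiples (A.simpleRoot i)).Finite := by
  rw [← Set.encard_ne_top_iff, A.encard_N_wordProd hω]
  clear hω
  induction ω with
  | nil => simp
  | cons i ω ih =>
    rw [List.map_cons, List.sum_cons, List.forall_mem_cons, ← ih, ← Set.encard_ne_top_iff, ne_eq,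
      ENat.add_eq_top, not_or]

/-! ### Multiples of simple roots and ON-paths -/

@[simp]
lemma pathProd_nil (x : I) : A.pathProd (.nil : A.onGraph.Walk x x) = 1 := rfl

@[simp]
lemma pathProd_cons {x y z : I} (h : A.onGraph.Adj x y) (p : A.onGraph.Walk y z) :
    A.pathProd (.cons h p) = A.K y x * A.pathProd p := rfl

lemma pathProd_append {x y z : I} (p : A.onGraph.Walk x y) (q : A.onGraph.Walk y z) :
    A.pathProd (p.append q) = A.pathProd p * A.pathProd q := by
  simp [pathProd]

lemma pathProd_pos {x y : I} (p : A.onGraph.Walk x y) : 0 < A.pathProd p := by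
  induction p with
  | nil => simp
  | cons h p ih => exact mul_pos (A.K_pos h.1 h.2) ih

lemma eq_smul_simpleRoot {u v : A.V} (hu : ∀ x, 0 ≤ u x) (hv : ∀ x, 0 ≤ v x) {p q c : ℝ}
    (hp : 0 < p) (hq : 0 < q) {x : I} (h : p • u + q • v = c • A.simpleRoot x) :
    u = u x • A.simpleRoot x := by
  ext y
  by_cases hy : x = y
  · simp [simpleRoot_eq, hy]
  · have h0 : A.simpleRoot x y = 0 := by rw [simpleRoot_eq, Finsupp.single_eq_of_ne' hy]
    have h1 := DFunLike.congr_fun h y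
    rw [Finsupp.add_apply, Finsupp.smul_apply, Finsupp.smul_apply, Finsupp.smul_apply, h0,
      smul_zero, smul_eq_mul, smul_eq_mul] at h1
    rw [Finsupp.smul_apply, h0, smul_zero]
    have h2 := mul_nonneg hq.le (hv y)
    exact le_antisymm (nonpos_of_mul_nonpos_right (by linarith) hp) (hu y)

lemma simpleRoot_not_smul {i j : I} (hij : i ≠ j) (c : ℝ) :
    A.simpleRoot i ≠ c • A.simpleRoot j := by
  intro h
  have h1 := DFunLike.congr_fun h i
  simp [simpleRoot_eq, hij] at h1

/-- If `w` maps a simple root to a positive multiple of a simple root, then the factor is the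
product along an ON-path. -/
theorem exists_walk_of_rep_simpleRoot (w : A.W) {y x : I} {c : ℝ} (hc : 0 < c)
    (h : A.rep w (A.simpleRoot y) = c • A.simpleRoot x) :
    ∃ p : A.onGraph.Walk y x, A.pathProd p = c := by
  induction hn : A.cs.length w using Nat.strong_induction_on generalizing w y c with
  | _ n ih =>
    subst hn
    by_cases hw : w = 1
    · subst hw
      rw [map_one, LinearEquiv.coe_one, id_eq] at h
      have hxy : y = x := by
        by_contra hxy
        exact A.simpleRoot_not_smul hxy c h
      subst hxy
      refine ⟨.nil, ?_⟩
      have := DFunLike.congr_fun h y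
      simpa [simpleRoot_eq] using this
    obtain ⟨j, hj⟩ := A.cs.exists_rightDescent_of_ne_one hw
    have hy : ¬A.cs.IsRightDescent w y := by
      intro hy
      have := A.rep_simpleRoot_nonpos w y hy x
      rw [h] at this
      simp [simpleRoot_eq] at this
      linarith
    have hyj : y ≠ j := by
      rintro rfl
      exact hy hj
    obtain ⟨v, k, rfl, hl, hvy, hvj, hk⟩ := A.exists_alternatingWord_factor hy hj
    obtain ⟨p, q, he, hpq⟩ := A.dihedral_trichotomy hyj hk
    rw [map_mul, LinearEquiv.mul_apply, he, map_add, map_smul, map_smul] at h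
    rcases hpq with ⟨-, ⟨hp, hq⟩ | ⟨rfl, rfl⟩⟩ | ⟨rfl, -, hm, rfl⟩
    -- With both coefficients positive, `v` would send `α y` and `α j` into the same line, against
    -- injectivity.
    · have h1 := A.eq_smul_simpleRoot (A.rep_simpleRoot_nonneg v y hvy)
        (A.rep_simpleRoot_nonneg v j hvj) hp hq h
      rw [add_comm] at h
      have h2 := A.eq_smul_simpleRoot (A.rep_simpleRoot_nonneg v j hvj)
        (A.rep_simpleRoot_nonneg v y hvy) hq hp h
      set a := A.rep v (A.simpleRoot y) x
      set b := A.rep v (A.simpleRoot j) x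
      have hb : b ≠ 0 := by
        intro hb
        rw [hb, zero_smul] at h2
        exact A.ne_zero_of_mem_roots (A.rep_mem_roots v (A.simpleRoot_mem_roots j)) h2
      refine absurd ?_ (A.simpleRoot_not_smul hyj (a / b))
      apply (A.rep v).injective
      rw [map_smul, h1, h2, smul_smul, div_mul_cancel₀ _ hb]
    · rw [one_smul, zero_smul, add_zero] at h
      exact ih _ hl v hc h rfl
    -- The split-off word is the edge from `y` to `j`; the rest of the path comes from the shorter
    -- `v`.
    · have hK := A.K_pos hyj hm
      rw [zero_smul, zero_add] at h
      have h' : A.rep v (A.simpleRoot j) = ((A.K j y)⁻¹ * c) • A.simpleRoot x := by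
        rw [mul_smul, ← h, smul_smul, inv_mul_cancel₀ hK.ne', one_smul]
      obtain ⟨p, hp⟩ := ih _ hl v (by positivity) h' rfl
      have hadj : A.onGraph.Adj y j := ⟨hyj, hm⟩
      exact ⟨.cons hadj p, by rw [pathProd_cons, hp, mul_inv_cancel_left₀ hK.ne']⟩

/-- Each edge is realized by the alternating word of length `m - 1`. -/
theorem exists_rep_simpleRoot_of_walk {y x : I} (p : A.onGraph.Walk y x) :
    ∃ w : A.W, A.rep w (A.simpleRoot y) = A.pathProd p • A.simpleRoot x := by
  induction p with
  | nil => exact ⟨1, by simp⟩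
  | @cons y z x h p ih =>
    obtain ⟨w, hw⟩ := ih
    have hpos := h.2.pos
    obtain ⟨a, b, he, hab⟩ := A.dihedral_trichotomy h.1 (k := A.m y z - 1) (Or.inr (by omega))
    rcases hab with ⟨hne, -⟩ | ⟨rfl, -, -, rfl⟩
    · exact absurd ⟨by omega, h.2⟩ hne
    · refine ⟨w * A.cs.wordProd (alternatingWord y z (A.m y z - 1)), ?_⟩
      rw [map_mul, LinearEquiv.mul_apply, he, zero_smul, zero_add, map_smul, hw, smul_smul,
        pathProd_cons]

/-- The products along the ON-paths that end in `x`. -/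
def pathValues (x : I) : Set ℝ := {c | ∃ (y : I) (p : A.onGraph.Walk y x), A.pathProd p = c}

theorem multiples_eq_image (x : I) :
    A.multiples (A.simpleRoot x) = (fun c : ℝ => c • A.simpleRoot x) '' A.pathValues x := by
  ext v
  rw [mem_multiples]
  constructor
  · rintro ⟨c, hc, rfl, w, y, h⟩
    obtain ⟨p, hp⟩ := A.exists_walk_of_rep_simpleRoot w hc h.symm
    exact ⟨c, ⟨y, p, hp⟩, rfl⟩
  · rintro ⟨_, ⟨y, p, rfl⟩, rfl⟩
    obtain ⟨w, hw⟩ := A.exists_rep_simpleRoot_of_walk p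
    exact ⟨_, A.pathProd_pos p, rfl, w, y, hw.symm⟩

theorem encard_multiples (x : I) :
    (A.multiples (A.simpleRoot x)).encard = (A.pathValues x).encard := by
  rw [multiples_eq_image]
  exact (smul_left_injective ℝ (A.simpleRoot_ne_zero x)).encard_image _

/-- Appending `p` multiplies the values by the nonzero number `pathProd p`, which is injective. -/
lemma encard_pathValues_le {x y : I} (p : A.onGraph.Walk x y) :
    (A.pathValues x).encard ≤ (A.pathValues y).encard := by
  rw [← (mul_left_injective₀ (A.pathProd_pos p).ne').encard_image (A.pathValues x)]
  apply Set.encard_le_encard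
  rintro _ ⟨_, ⟨z, q, rfl⟩, rfl⟩
  exact ⟨z, q.append p, A.pathProd_append q p⟩

lemma encard_pathValues_eq {x y : I} (h : A.onGraph.Reachable x y) :
    (A.pathValues x).encard = (A.pathValues y).encard := by
  obtain ⟨p⟩ := h
  exact le_antisymm (A.encard_pathValues_le p) (A.encard_pathValues_le p.reverse)

/-- Going round the cycle repeatedly yields all powers of its product, a positive number; these are
distinct unless it is 1. -/
lemma pathProd_eq_one_of_finite {x : I} (hx : (A.pathValues x).Finite)
    (c : A.onGraph.Walk x x) : A.pathProd c = 1 := by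
  by_contra h
  have hmem : ∀ n : ℕ, A.pathProd c ^ n ∈ A.pathValues x := by
    intro n
    induction n with
    | zero => exact ⟨x, .nil, by simp⟩
    | succ n ih =>
      obtain ⟨y, p, hp⟩ := ih
      exact ⟨y, p.append c, by rw [pathProd_append, hp, pow_succ]⟩
  exact Set.infinite_of_injective_forall_mem (pow_right_injective₀ (A.pathProd_pos c) h) hmem hx

theorem unitalONCyclic_of_finite (hA : A.ONConnected) {x : I} (hx : (A.pathValues x).Finite) :
    A.UnitalONCyclic := by
  intro y c
  refine A.pathProd_eq_one_of_finite ?_ c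
  rw [← Set.encard_ne_top_iff] at hx ⊢
  rwa [A.encard_pathValues_eq (hA.preconnected y x)]

/-! ### ON-connected components -/

lemma restrict_m (s : Set I) (x y : s) : (A.restrict s).m x y = A.m x y := by
  by_cases h : x = y
  · rw [h, m_self, m_self]
  · have h' : (x : I) ≠ y := Subtype.coe_injective.ne h
    simp only [m, h, h', if_false, restrict, Matrix.submatrix_apply]

lemma restrict_K (s : Set I) (x y : s) : (A.restrict s).K x y = A.K x y := by
  rw [K, K, restrict_m]
  rfl

lemma restrict_onGraph_adj (s : Set I) (x y : s) :
    (A.restrict s).onGraph.Adj x y ↔ A.onGraph.Adj x y := by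
  change x ≠ y ∧ Odd ((A.restrict s).m x y) ↔ (x : I) ≠ y ∧ Odd (A.m x y)
  rw [restrict_m, Ne, Ne, Subtype.coe_inj]

lemma exists_walk_of_restrict (s : Set I) {x y : s} (p : (A.restrict s).onGraph.Walk x y) :
    ∃ q : A.onGraph.Walk (x : I) y, A.pathProd q = (A.restrict s).pathProd p := by
  induction p with
  | nil => exact ⟨.nil, rfl⟩
  | cons h p ih =>
    obtain ⟨q, hq⟩ := ih
    exact ⟨.cons ((A.restrict_onGraph_adj s _ _).1 h) q, by
      rw [pathProd_cons, pathProd_cons, hq, restrict_K]⟩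

lemma exists_walk_component (C : A.onGraph.ConnectedComponent) {y x : I} (p : A.onGraph.Walk y x)
    (hx : x ∈ C.supp) : ∃ (hy : y ∈ C.supp) (q : (A.component C).onGraph.Walk ⟨y, hy⟩ ⟨x, hx⟩),
      (A.component C).pathProd q = A.pathProd p := by
  induction p with
  | nil => exact ⟨hx, .nil, rfl⟩
  | @cons y z x h p ih =>
    obtain ⟨hz, q, hq⟩ := ih hx
    have hy : y ∈ C.supp := C.mem_supp_of_adj_mem_supp hz h.symm
    exact ⟨hy, .cons ((A.restrict_onGraph_adj C.supp ⟨y, hy⟩ ⟨z, hz⟩).2 h) q, by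
      rw [pathProd_cons, pathProd_cons, hq, restrict_K]⟩

lemma component_onConnected (C : A.onGraph.ConnectedComponent) :
    (A.component C).ONConnected := by
  rw [ONConnected, SimpleGraph.connected_iff]
  refine ⟨fun y x => ?_, inferInstance⟩
  obtain ⟨p⟩ : A.onGraph.Reachable (y : I) x :=
    SimpleGraph.ConnectedComponent.exact (y.2.trans x.2.symm)
  obtain ⟨_, q, -⟩ := A.exists_walk_component C p x.2
  exact ⟨q⟩

/-- An ON-path ending in a component never leaves it. This is why sizes computed in `Φ_{A'}` and in
`Φ_A` agree. -/
lemma component_pathValues (C : A.onGraph.ConnectedComponent) (x : C.supp) :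
    (A.component C).pathValues x = A.pathValues x := by
  ext c
  constructor
  · rintro ⟨y, p, rfl⟩
    obtain ⟨q, hq⟩ := A.exists_walk_of_restrict C.supp p
    exact ⟨y, q, hq⟩
  · rintro ⟨y, p, rfl⟩
    obtain ⟨hy, q, hq⟩ := A.exists_walk_component C p x.2
    exact ⟨⟨y, hy⟩, q, hq⟩

lemma component_encard_multiples (C : A.onGraph.ConnectedComponent) (x y : C.supp) :
    ((A.component C).multiples ((A.component C).simpleRoot x)).encard =
      (A.multiples (A.simpleRoot y)).encard := by
  rw [encard_multiples, encard_multiples, ← component_pathValues]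
  exact (A.component C).encard_pathValues_eq ((A.component_onConnected C).preconnected x y)

lemma component_f (C : A.onGraph.ConnectedComponent) (x : C.supp) :
    (A.component C).f = (A.multiples (A.simpleRoot x)).ncard := by
  rw [f, Set.ncard_def, A.component_encard_multiples C _ x, Set.ncard_def]

end EGCM

/-! ### Finiteness and size of `N(w)` -/

open EGCM in
theorem theorem3p9 {I : Type*} [Finite I] (A : EGCM I) (w : A.W) (hw : 0 < A.cs.length w) :
    ((A.N w).Finite ↔
      ∃ ω : List I, A.IsReducedExpr w ω ∧ ∀ i ∈ ω, (A.multiples (A.simpleRoot i)).Finite) ∧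
    ((A.N w).Finite ↔
      ∀ ω : List I, A.IsReducedExpr w ω → ∀ i ∈ ω, (A.multiples (A.simpleRoot i)).Finite) ∧
    (∀ ω : List I, A.IsReducedExpr w ω → (A.N w).Finite →
      (∀ C ∈ A.componentsMeeting {i | i ∈ ω},
        (A.component C).ONConnected ∧ (A.component C).UnitalONCyclic ∧
        ∀ x : C.supp, ((A.component C).multiples ((A.component C).simpleRoot x)).Finite ∧
          ((A.component C).multiples ((A.component C).simpleRoot x)).ncard =
            (A.component C).f) ∧
      ∃ f₁ f₂ : ℕ,
        IsLeast ((fun C => (A.component C).f) '' A.componentsMeeting {i | i ∈ ω}) f₁ ∧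
        IsGreatest ((fun C => (A.component C).f) '' A.componentsMeeting {i | i ∈ ω}) f₂ ∧
        f₁ * A.cs.length w ≤ (A.N w).ncard ∧ (A.N w).ncard ≤ f₂ * A.cs.length w) := by
  have hfin : ∀ ω, A.IsReducedExpr w ω →
      ((A.N w).Finite ↔ ∀ i ∈ ω, (A.multiples (A.simpleRoot i)).Finite) := by
    rintro ω ⟨rfl, hω⟩
    exact A.finite_N_wordProd_iff hω
  obtain ⟨ω₀, hr₀, hω₀⟩ := A.cs.exists_isReduced w
  have h₀ : A.IsReducedExpr w ω₀ := ⟨hω₀.symm, hr₀⟩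
  refine ⟨⟨fun h => ⟨ω₀, h₀, (hfin ω₀ h₀).1 h⟩, fun ⟨ω, h, h'⟩ => (hfin ω h).2 h'⟩,
    ⟨fun h ω hω => (hfin ω hω).1 h, fun h => (hfin ω₀ h₀).2 (h ω₀ h₀)⟩, ?_⟩
  intro ω hω hN
  have hmult := (hfin ω hω).1 hN
  refine ⟨?_, ?_⟩
  · rintro C ⟨x, hxω, hxC⟩
    have hx := hmult x hxω
    refine ⟨A.component_onConnected C, ?_, fun y => ⟨?_, ?_⟩⟩
    · refine (A.component C).unitalONCyclic_of_finite (A.component_onConnected C)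
        (x := ⟨x, hxC⟩) ?_
      rwa [component_pathValues, ← Set.encard_ne_top_iff, ← encard_multiples,
        Set.encard_ne_top_iff]
    · rwa [← Set.encard_ne_top_iff, A.component_encard_multiples C y ⟨x, hxC⟩,
        Set.encard_ne_top_iff]
    · rw [A.component_f C ⟨x, hxC⟩, Set.ncard_def, A.component_encard_multiples C y ⟨x, hxC⟩,
        Set.ncard_def]
  · set S := (fun C => (A.component C).f) '' A.componentsMeeting {i | i ∈ ω}
    have hmem : ∀ i ∈ ω, (A.multiples (A.simpleRoot i)).ncard ∈ S := fun i hi =>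
      ⟨A.onGraph.connectedComponentMk i, ⟨i, hi, rfl⟩,
        A.component_f (A.onGraph.connectedComponentMk i) ⟨i, rfl⟩⟩
    have hSfin : S.Finite := Set.Finite.image _ (Set.toFinite _)
    obtain ⟨hprod, hred⟩ := hω
    have hlen : A.cs.length w = ω.length := by rw [← hprod, hred.eq]
    -- Positive length supplies a letter, hence a component; without one the minimum would not
    -- exist.
    have hSne : S.Nonempty := by
      obtain ⟨i, hi⟩ := List.exists_mem_of_length_pos (hlen ▸ hw)
      exact ⟨_, hmem i hi⟩
    have hcard : (A.N w).ncard = (ω.map fun i => (A.multiples (A.simpleRoot i)).ncard).sum := by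
      have h := A.encard_N_wordProd hred
      rw [hprod] at h
      have hcast : ∀ l : List I, (∀ i ∈ l, (A.multiples (A.simpleRoot i)).Finite) →
          (l.map fun i => (A.multiples (A.simpleRoot i)).encard).sum =
            ((l.map fun i => (A.multiples (A.simpleRoot i)).ncard).sum : ℕ) := by
        intro l hl
        induction l with
        | nil => simp
        | cons i l ih =>
          rw [List.forall_mem_cons] at hl
          rw [List.map_cons, List.sum_cons, ih hl.2, List.map_cons, List.sum_cons, Nat.cast_add,
            hl.1.cast_ncard_eq]
      rw [hcast ω hmult] at h
      rw [Set.ncard_def, h, ENat.toNat_natCast]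
    obtain ⟨f₁, hf₁⟩ : ∃ f₁, IsLeast S f₁ :=
      ⟨sInf S, Nat.sInf_mem hSne, fun _ h => Nat.sInf_le h⟩
    obtain ⟨f₂, hf₂⟩ : ∃ f₂, IsGreatest S f₂ :=
      Set.exists_max_image S id hSfin hSne
    refine ⟨f₁, f₂, hf₁, hf₂, ?_, ?_⟩
    · rw [hcard, hlen, mul_comm]
      simpa using List.card_nsmul_le_sum
        (ω.map fun i => (A.multiples (A.simpleRoot i)).ncard) f₁ (by
          simpa using fun i hi => hf₁.2 (hmem i hi))
    · rw [hcard, hlen, mul_comm]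
      simpa using List.sum_le_card_nsmul
        (ω.map fun i => (A.multiples (A.simpleRoot i)).ncard) f₂ (by
          simpa using fun i hi => hf₂.2 (hmem i hi))
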